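/- Let $q : E \to B$ be a continuous map of topological spaces and let $n \ge 2$. Let $E_B^{n} = \{(e_1,\dots,e_n) \in E^n : q(e_1) = \dots = q(e_n)\}$ be the $n$-fold fibre product, and let $P_n^B(E)$ be the space (with the topology induced from the compact-open topology) of all $n$-tuples $(\gamma_1,\dots,\gamma_n)$ of continuous paths $\gamma_i : [0,1] \to E$ with a common initial point $\gamma_1(0) = \dots = \gamma_n(0)$ such that each $q \circ \gamma_i$ is constant. The $n$-th parametrised topological complexity $\mathrm{TC}_n[q : E \to B]$ is the (non-reduced) Schwarz genus of the evaluation map $$P_n^B(E) \to E_B^{n}, \qquad (\gamma_1,\dots,\gamma_n) \mapsto (\gamma_1(1),\dots,\gamma_n(1)),$$ that is, the least positive integer $r$ such that $E_B^{n}$ is covered by $r$ open sets over each of which this map has a continuous section (and $\infty$ if there is no such $r$). Let $q : S^3 \to S^2$ be the Hopf fibration, $q(z,w) = (2\,\mathrm{Re}(z\bar w),\, 2\,\mathrm{Im}(z\bar w),\, |z|^2 - |w|^2)$ for $(z,w) \in S^3 \subset \mathbb{C}^2$. Then for every integer $n \ge 2$, $$2 \le \mathrm{TC}_n[q : S^3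 \to S^2] \le n.$$ -/

import Mathlib

/-- The Schwarz genus (sectional category) of a continuous map `p : E → B`, not reduced: the least
positive integer `r` such that `B` has a cover by `r` open sets over each of which `p` has a
continuous section. It is `⊤` when there is no such `r`. -/
noncomputable def schwarzGenus {E B : Type*} [TopologicalSpace E] [TopologicalSpace B]
    (p : C(E, B)) : ℕ∞ :=
  ⨅ (r : ℕ) (_ : 1 ≤ r ∧ ∃ U : Fin r → Set B, (∀ j, IsOpen (U j)) ∧ (⋃ j, U j) = Set.univ ∧
    ∀ j, ∃ s : C(U j, E), ∀ b : U j, p (s b) = (b : B)), (r : ℕ∞)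

/-- The `n`-fold fibre product `E ×_B E ×_B ⋯ ×_B E` of `q : E → B`, as a subspace of `E ^ n`. -/
abbrev FibreProduct {E B : Type*} [TopologicalSpace E] [TopologicalSpace B]
    (q : C(E, B)) (n : ℕ) : Type _ :=
  {e : Fin n → E // ∀ i j, q (e i) = q (e j)}

/-- The space of vertical multipaths of `q : E → B`: families of `n` paths in `E` with a common
initial point, each of which stays in a single fibre of `q` (that is, `q ∘ γ i` is constant).
Path spaces carry the compact-open topology. -/
abbrev VerticalMultipath {E B : Type*} [TopologicalSpace E] [TopologicalSpace B]
    (q : C(E, B)) (n : ℕ) : Type _ :=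
  {γ : Fin n → C(unitInterval, E) //
    (∀ i j, γ i 0 = γ j 0) ∧ ∀ i t, q (γ i t) = q (γ i 0)}

/-- The evaluation `(γ₁, …, γₙ) ↦ (γ₁(1), …, γₙ(1))` at the end points. -/
def multipathEnd {E B : Type*} [TopologicalSpace E] [TopologicalSpace B]
    (q : C(E, B)) (n : ℕ) : C(VerticalMultipath q n, FibreProduct q n) where
  toFun γ := ⟨fun i => γ.1 i 1, fun i j => by
    rw [γ.2.2 i 1, γ.2.2 j 1, γ.2.1 i j]⟩
  continuous_toFun := by
    refine Continuous.subtype_mk (continuous_pi fun i => ?_) _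
    exact (continuous_eval_const (1 : unitInterval)).comp
      ((continuous_apply i).comp continuous_subtype_val)

/-- The `n`-th parametrised (higher) topological complexity `TC_n[q : E → B]`. -/
noncomputable def parametrisedTC {E B : Type*} [TopologicalSpace E] [TopologicalSpace B]
    (q : C(E, B)) (n : ℕ) : ℕ∞ :=
  schwarzGenus (multipathEnd q n)

/-- The three-sphere: the unit sphere of `ℂ²`. -/
abbrev Sphere3 : Type := Metric.sphere (0 : EuclideanSpace ℂ (Fin 2)) 1

/-- The two-sphere: the unit sphere of `ℝ³`. -/
abbrev Sphere2 : Type := Metric.sphere (0 : EuclideanSpace ℝ (Fin 3)) 1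

/-- The Hopf fibration `S³ → S²`,
`(z, w) ↦ (2 Re (z w̄), 2 Im (z w̄), |z|² - |w|²)`. -/
noncomputable def hopfMap : C(Sphere3, Sphere2) where
  toFun x := ⟨!₂[2 * (x.1 0 * (starRingEnd ℂ) (x.1 1)).re,
      2 * (x.1 0 * (starRingEnd ℂ) (x.1 1)).im,
      ‖x.1 0‖ ^ 2 - ‖x.1 1‖ ^ 2], by
    have hx : ‖x.1‖ = 1 := by simp
    have h : ‖x.1 0‖ ^ 2 + ‖x.1 1‖ ^ 2 = 1 := by
      have := EuclideanSpace.norm_sq_eq x.1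
      rw [hx, Fin.sum_univ_two] at this
      linarith
    rw [mem_sphere_zero_iff_norm, EuclideanSpace.norm_eq, Real.sqrt_eq_one]
    simp only [Complex.sq_norm, Complex.normSq_apply] at h
    simp only [Fin.sum_univ_three, Real.norm_eq_abs, sq_abs, Complex.sq_norm, Complex.normSq_apply,
      Complex.mul_re, Complex.mul_im, Complex.conj_re, Complex.conj_im]
    simp only [Matrix.cons_val]
    linear_combination ((x.1 0).re * (x.1 0).re + (x.1 0).im * (x.1 0).im
      + ((x.1 1).re * (x.1 1).re + (x.1 1).im * (x.1 1).im) + 1) * h⟩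
  continuous_toFun := by
    refine Continuous.subtype_mk ?_ _
    refine (PiLp.continuous_toLp 2 _).comp (continuous_pi fun i => ?_)
    fin_cases i <;> simp <;> fun_prop

/-! The Hopf map is a principal circle bundle, so a point of the fibre product amounts to a base
coordinate together with the ratios `hopfRatio` in the circle. Sections of the evaluation come from
continuous arguments of these ratios (`exists_section_of_argument`). Upper bound: fix `n` cut points
on the circle, none equal to `1`; over the open set where every ratio avoids the `j`-th one,
arguments exist. At most `n - 1` ratios differ from `1`, so some cut point is always avoided. Lower
bound: a global section would contract the circle (`not_exists_section_multipathEnd_hopfMap`). -/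

open unitInterval

/-- The scalar action of the circle on the three-sphere. -/
noncomputable def circleRotate (u : Circle) (x : Sphere3) : Sphere3 :=
  ⟨(u : ℂ) • x.1, by rw [mem_sphere_zero_iff_norm, norm_smul, Circle.norm_coe, one_mul, norm_eq_of_mem_sphere x]⟩

theorem continuous_circleRotate : Continuous fun p : Circle × Sphere3 => circleRotate p.1 p.2 :=
  Continuous.subtype_mk (by fun_prop) _

theorem circleRotate_one (x : Sphere3) : circleRotate 1 x = x :=
  Subtype.ext (by simp [circleRotate])

theorem Sphere3.norm_sq_add_norm_sq (x : Sphere3) : ‖x.1 0‖ ^ 2 + ‖x.1 1‖ ^ 2 = 1 := by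
  have h := EuclideanSpace.norm_sq_eq x.1
  rw [norm_eq_of_mem_sphere x, Fin.sum_univ_two] at h
  linarith

theorem hopfMap_eq_iff {x y : Sphere3} : hopfMap x = hopfMap y ↔
    x.1 0 * (starRingEnd ℂ) (x.1 1) = y.1 0 * (starRingEnd ℂ) (y.1 1) ∧
      ‖x.1 0‖ ^ 2 = ‖y.1 0‖ ^ 2 ∧ ‖x.1 1‖ ^ 2 = ‖y.1 1‖ ^ 2 := by
  have hx := Sphere3.norm_sq_add_norm_sq x
  have hy := Sphere3.norm_sq_add_norm_sq y
  constructor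
  · intro h
    have hc (i : Fin 3) : (hopfMap x).1 i = (hopfMap y).1 i := by rw [h]
    have h0 : 2 * (x.1 0 * (starRingEnd ℂ) (x.1 1)).re =
      2 * (y.1 0 * (starRingEnd ℂ) (y.1 1)).re := hc 0
    have h1 : 2 * (x.1 0 * (starRingEnd ℂ) (x.1 1)).im =
      2 * (y.1 0 * (starRingEnd ℂ) (y.1 1)).im := hc 1
    have h2 : ‖x.1 0‖ ^ 2 - ‖x.1 1‖ ^ 2 = ‖y.1 0‖ ^ 2 - ‖y.1 1‖ ^ 2 := hc 2
    exact ⟨Complex.ext (by linarith) (by linarith), by linarith, by linarith⟩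
  · rintro ⟨h, h0, h1⟩
    refine Subtype.ext ?_
    change !₂[_, _, _] = !₂[_, _, _]
    rw [h, h0, h1]

theorem hopfMap_circleRotate (u : Circle) (x : Sphere3) :
    hopfMap (circleRotate u x) = hopfMap x := by
  have hu : (u : ℂ) * (starRingEnd ℂ) (u : ℂ) = 1 := by
    rw [Complex.mul_conj, Circle.normSq_coe, Complex.ofReal_one]
  refine hopfMap_eq_iff.2 ⟨?_, ?_, ?_⟩
  · simp only [circleRotate, PiLp.smul_apply, smul_eq_mul, map_mul]
    linear_combination (x.1 0 * (starRingEnd ℂ) (x.1 1)) * hu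
  · simp [circleRotate, Circle.norm_coe]
  · simp [circleRotate, Circle.norm_coe]

/-- Two points of a fibre of the Hopf map differ by their Hermitian inner product. -/
theorem inner_smul_eq_of_hopfMap_eq {x y : Sphere3} (h : hopfMap x = hopfMap y) :
    inner ℂ x.1 y.1 • x.1 = y.1 := by
  obtain ⟨hc, h0, h1⟩ := hopfMap_eq_iff.1 h
  have hy := Sphere3.norm_sq_add_norm_sq y
  have hc' := congrArg (starRingEnd ℂ) hc
  simp only [map_mul, Complex.conj_conj] at hc'
  -- Entrywise, the rank-one matrices `x x*` and `y y*` agree; applying both to `y` gives the claim,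
  -- since `y* y = 1`.
  have e0 : x.1 0 * (starRingEnd ℂ) (x.1 0) = y.1 0 * (starRingEnd ℂ) (y.1 0) := by
    rw [Complex.mul_conj, Complex.mul_conj, Complex.normSq_eq_norm_sq, Complex.normSq_eq_norm_sq, h0]
  have e1 : x.1 1 * (starRingEnd ℂ) (x.1 1) = y.1 1 * (starRingEnd ℂ) (y.1 1) := by
    rw [Complex.mul_conj, Complex.mul_conj, Complex.normSq_eq_norm_sq, Complex.normSq_eq_norm_sq, h1]
  have ey : y.1 0 * (starRingEnd ℂ) (y.1 0) + y.1 1 * (starRingEnd ℂ) (y.1 1) = 1 := by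
    rw [Complex.mul_conj, Complex.mul_conj, Complex.normSq_eq_norm_sq, Complex.normSq_eq_norm_sq,
      ← Complex.ofReal_add, hy, Complex.ofReal_one]
  ext i
  simp only [PiLp.inner_apply, Fin.sum_univ_two, RCLike.inner_apply, PiLp.smul_apply, smul_eq_mul]
  fin_cases i
  · simp only [Fin.zero_eta]
    linear_combination y.1 0 * e0 + y.1 1 * hc + y.1 0 * ey
  · simp only [Fin.mk_one]
    linear_combination y.1 0 * hc' + y.1 1 * e1 + y.1 1 * ey

/-- The element of the circle that carries `x` to `y`, for `x` and `y` in a fibre of the Hopf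
map. -/
noncomputable def hopfRatio (x y : Sphere3) (h : hopfMap x = hopfMap y) : Circle :=
  ⟨inner ℂ x.1 y.1, by
    have := congrArg norm (inner_smul_eq_of_hopfMap_eq h)
    rw [norm_smul, norm_eq_of_mem_sphere x, norm_eq_of_mem_sphere y, mul_one] at this
    exact mem_sphere_zero_iff_norm.2 this⟩

theorem circleRotate_hopfRatio {x y : Sphere3} (h : hopfMap x = hopfMap y) :
    circleRotate (hopfRatio x y h) x = y :=
  Subtype.ext (inner_smul_eq_of_hopfMap_eq h)

theorem hopfRatio_circleRotate {x y : Sphere3} (u : Circle) (h : hopfMap x = hopfMap y)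
    (hy : y = circleRotate u x) : hopfRatio x y h = u := by
  subst hy
  refine Circle.ext ?_
  change inner ℂ x.1 ((u : ℂ) • x.1) = u
  rw [inner_smul_right, inner_self_eq_norm_sq_to_K, norm_eq_of_mem_sphere x]
  simp

theorem continuous_hopfRatio {X : Type*} [TopologicalSpace X] {f g : X → Sphere3}
    (hf : Continuous f) (hg : Continuous g) (h : ∀ a, hopfMap (f a) = hopfMap (g a)) :
    Continuous fun a => hopfRatio (f a) (g a) (h a) :=
  Continuous.subtype_mk
    ((continuous_subtype_val.comp hf).inner (continuous_subtype_val.comp hg)) _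

theorem Circle.neg_coe_mem_slitPlane {g : Circle} (hg : g ≠ 1) :
    ((-g : Circle) : ℂ) ∈ Complex.slitPlane := by
  rw [Complex.mem_slitPlane_iff_arg]
  refine ⟨fun h => hg ?_, Circle.coe_ne_zero _⟩
  have h1 := Circle.exp_arg (-g)
  rw [h] at h1
  have h2 : (Circle.exp Real.pi : ℂ) = -1 := by simp
  rw [h1] at h2
  refine Circle.ext ?_
  simpa using h2

/-- A choice of argument on the circle, continuous away from `c`. -/
noncomputable def argAvoiding (c g : Circle) : ℝ :=
  Complex.arg ((-(g / c) : Circle) : ℂ) + Complex.arg ((-c : Circle) : ℂ)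

theorem exp_argAvoiding (c g : Circle) : Circle.exp (argAvoiding c g) = g := by
  rw [argAvoiding, Circle.exp_add, Circle.exp_arg, Circle.exp_arg, neg_mul_neg, div_mul_cancel]

/-- The sign in `-(g / c)` moves the branch cut of `Complex.arg` from `-1` to `g = c`. -/
theorem continuous_argAvoiding {X : Type*} [TopologicalSpace X] (c : Circle) {f : X → Circle}
    (hf : Continuous f) (h : ∀ x, f x ≠ c) : Continuous fun x => argAvoiding c (f x) := by
  refine Continuous.add (continuous_iff_continuousAt.2 fun x => ?_) continuous_const
  have hx : f x / c ≠ 1 := fun e => h x (div_eq_one.1 e)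
  refine ContinuousAt.comp (f := fun x => ((-(f x / c) : Circle) : ℂ))
    (Complex.continuousAt_arg (Circle.neg_coe_mem_slitPlane hx)) ?_
  have : Continuous fun x => -((f x / c : Circle) : ℂ) :=
    (continuous_subtype_val.comp (hf.div' continuous_const)).neg
  simpa using this.continuousAt

theorem exists_injective_circle_ne_one (n : ℕ) :
    ∃ c : Fin n → Circle, Function.Injective c ∧ ∀ j, c j ≠ 1 := by
  have hm (j : Fin n) : (1 : ℝ) / ((j : ℕ) + 1) ∈ Set.Icc (0 : ℝ) 1 :=
    ⟨by positivity, by rw [div_le_one (by positivity)]; linarith [Nat.cast_nonneg (α := ℝ) j]⟩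
  have hinj := Circle.exp_injOn_Icc (a := 0) (b := 1) (by linarith [Real.pi_gt_three])
  refine ⟨fun j => Circle.exp (1 / ((j : ℕ) + 1)), fun i j h => ?_, fun j h => ?_⟩
  · have := hinj (hm i) (hm j) h
    field_simp at this
    exact Fin.ext (by exact_mod_cast (add_right_cancel this).symm)
  · have h0 : (1 : ℝ) / ((j : ℕ) + 1) = 0 :=
      hinj (hm j) ⟨le_rfl, zero_le_one⟩ (h.trans Circle.exp_zero.symm)
    have : (0 : ℝ) < 1 / ((j : ℕ) + 1) := by positivity
    exact this.ne' h0

/-- A continuous argument for all ratios to one coordinate gives a section of the evaluation of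
vertical multipaths. -/
theorem exists_section_of_argument {n : ℕ} (i₀ : Fin n) (U : Set (FibreProduct hopfMap n))
    (θ : Fin n → C(U, ℝ))
    (hθ : ∀ i e, Circle.exp (θ i e) = hopfRatio (e.1.1 i₀) (e.1.1 i) (e.1.2 i₀ i)) :
    ∃ s : C(U, VerticalMultipath hopfMap n), ∀ e : U, multipathEnd hopfMap n (s e) = e := by
  -- The `i`-th path rotates the base coordinate through the angle `t * θ i`, hence stays in its
  -- fibre.
  let F (i : Fin n) : C(U × I, Sphere3) :=
    ⟨fun p => circleRotate (Circle.exp (p.2 * θ i p.1)) (p.1.1.1 i₀),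
      continuous_circleRotate.comp (Continuous.prodMk (by fun_prop)
        ((continuous_apply i₀).comp
          (continuous_subtype_val.comp (continuous_subtype_val.comp continuous_fst))))⟩
  have hF0 (i : Fin n) (e : U) : F i (e, 0) = e.1.1 i₀ := by
    simp [F, circleRotate_one]
  refine ⟨⟨fun e => ⟨fun i => (F i).curry e, fun i j => ?_, fun i t => ?_⟩, ?_⟩, fun e => ?_⟩
  · exact (hF0 i e).trans (hF0 j e).symm
  · change hopfMap (F i (e, t)) = hopfMap (F i (e, 0))
    rw [hF0]
    exact hopfMap_circleRotate _ _
  · exact Continuous.subtype_mk (continuous_pi fun i => (F i).curry.continuous) _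
  · refine Subtype.ext (funext fun i => ?_)
    change F i (e, 1) = e.1.1 i
    simp only [F, ContinuousMap.coe_mk, Set.Icc.coe_one, one_mul, hθ]
    exact circleRotate_hopfRatio _

theorem parametrisedTC_hopfMap_le {n : ℕ} (hn : 1 ≤ n) :
    parametrisedTC hopfMap n ≤ (n : ℕ∞) := by
  obtain ⟨c, hc, hc1⟩ := exists_injective_circle_ne_one n
  let i₀ : Fin n := ⟨0, hn⟩
  let r (i : Fin n) (e : FibreProduct hopfMap n) : Circle :=
    hopfRatio (e.1 i₀) (e.1 i) (e.2 i₀ i)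
  have hr (i : Fin n) : Continuous (r i) :=
    continuous_hopfRatio ((continuous_apply i₀).comp continuous_subtype_val)
      ((continuous_apply i).comp continuous_subtype_val) _
  refine iInf₂_le n ⟨hn, fun j => {e | ∀ i, r i e ≠ c j}, fun j => ?_, ?_, fun j => ?_⟩
  · simp only [Set.ofPred_forall]
    exact isOpen_iInter_of_finite fun i => isOpen_ne_fun (hr i) continuous_const
  · refine Set.eq_univ_of_forall fun e => ?_
    by_contra hcov
    simp only [Set.mem_iUnion, Set.mem_ofPred_eq, not_exists, not_forall, not_not] at hcov
    -- Pigeonhole: if every cut point is a ratio, the injective `k` is onto and hits `i₀`, whose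
    -- ratio is `1`, which is no cut point.
    choose k hk using hcov
    have hkinj : Function.Injective k := fun a b hab => hc (by rw [← hk a, ← hk b, hab])
    obtain ⟨j, hj⟩ := (Finite.injective_iff_surjective.1 hkinj) i₀
    refine hc1 j ?_
    rw [← hk j, hj]
    exact hopfRatio_circleRotate 1 _ (circleRotate_one _).symm
  · exact exists_section_of_argument i₀ _
      (fun i => ⟨fun e => argAvoiding (c j) (r i e.1),
        continuous_argAvoiding (c j) ((hr i).comp continuous_subtype_val) fun e => e.2 i⟩)
      fun i e => exp_argAvoiding _ _

/-- Borsuk–Ulam on the circle: the difference of `θ` at antipodal points changes sign over half a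
turn, so it vanishes somewhere, and antipodal points would coincide. -/
theorem not_exists_continuous_argument :
    ¬ ∃ θ : Circle → ℝ, Continuous θ ∧ ∀ g, Circle.exp (θ g) = g := by
  rintro ⟨θ, hθ, h⟩
  let f (t : ℝ) : ℝ := θ (Circle.exp t) - θ (Circle.exp (t + Real.pi))
  have hf : Continuous f := by fun_prop
  have hf0 : f Real.pi = -f 0 := by
    simp only [f, ← two_mul, Circle.exp_two_pi, Circle.exp_zero, zero_add, neg_sub]
  obtain ⟨t, ht⟩ : ∃ t, f t = 0 := by
    rcases le_total (f 0) 0 with h0 | h0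
    · exact mem_range_of_exists_le_of_exists_ge hf ⟨0, h0⟩ ⟨Real.pi, by rw [hf0]; linarith⟩
    · exact mem_range_of_exists_le_of_exists_ge hf ⟨Real.pi, by rw [hf0]; linarith⟩ ⟨0, h0⟩
  have he := congrArg Circle.exp (sub_eq_zero.1 ht)
  rw [h, h, Circle.exp_add] at he
  have h1 : (Circle.exp Real.pi : ℂ) = 1 := by rw [left_eq_mul.1 he, Circle.coe_one]
  have h2 : (Circle.exp Real.pi : ℂ) = -1 := by simp
  rw [h1] at h2
  norm_num at h2

/-- Lifting the homotopy through the covering `Circle.exp`, from the constant `0`, would end in a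
continuous argument. -/
theorem Circle.not_exists_contraction :
    ¬ ∃ H : C(I × Circle, Circle), ∀ g, H (0, g) = 1 ∧ H (1, g) = g := by
  rintro ⟨H, hH⟩
  have h0 (g : Circle) : H (0, g) = Circle.exp ((ContinuousMap.const Circle (0 : ℝ)) g) := by
    simp [(hH g).1]
  let L := Circle.isCoveringMap_exp.liftHomotopy H (.const Circle 0) h0
  refine not_exists_continuous_argument ⟨fun g => L (1, g), by fun_prop, fun g => ?_⟩
  exact (congrFun (Circle.isCoveringMap_exp.liftHomotopy_lifts H _ h0) (1, g)).trans (hH g).2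

/-- Restrict the section to a loop in which only coordinate `i₁` turns, once around a fibre. The
ratio of paths `i₀` and `i₁` is `1` at time `0` (common initial point) and `g` at time `1`. -/
theorem not_exists_section_multipathEnd_hopfMap {n : ℕ} (hn : 2 ≤ n) :
    ¬ ∃ s : C(FibreProduct hopfMap n, VerticalMultipath hopfMap n),
      ∀ e, multipathEnd hopfMap n (s e) = e := by
  rintro ⟨s, hs⟩
  let x₀ : Sphere3 := ⟨EuclideanSpace.single 0 1, by simp⟩
  let i₀ : Fin n := ⟨0, by lia⟩
  let i₁ : Fin n := ⟨1, hn⟩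
  have hne : i₀ ≠ i₁ := by simp [i₀, i₁]
  have hq (g : Circle) (i : Fin n) :
      hopfMap (if i = i₁ then circleRotate g x₀ else x₀) = hopfMap x₀ := by
    split_ifs
    · exact hopfMap_circleRotate g x₀
    · rfl
  let ν (g : Circle) : FibreProduct hopfMap n :=
    ⟨fun i => if i = i₁ then circleRotate g x₀ else x₀, fun i j => (hq g i).trans (hq g j).symm⟩
  have hν : Continuous ν := by
    refine Continuous.subtype_mk (continuous_pi fun i => ?_) _
    split_ifs
    · exact continuous_circleRotate.comp (by fun_prop : Continuous fun g : Circle => (g, x₀))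
    · exact continuous_const
  have hγ (i : Fin n) : Continuous fun p : I × Circle => (s (ν p.2)).1 i p.1 := by
    have : Continuous fun g => (s (ν g)).1 i :=
      (continuous_apply i).comp (continuous_subtype_val.comp (s.continuous.comp hν))
    exact continuous_eval.comp ((this.comp continuous_snd).prodMk continuous_fst)
  have hend (g : Circle) (i : Fin n) :
      (s (ν g)).1 i 1 = if i = i₁ then circleRotate g x₀ else x₀ :=
    congrFun (congrArg Subtype.val (hs (ν g))) i
  have hfib (p : I × Circle) :
      hopfMap ((s (ν p.2)).1 i₀ p.1) = hopfMap ((s (ν p.2)).1 i₁ p.1) := by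
    rw [(s (ν p.2)).2.2 i₀, (s (ν p.2)).2.2 i₁, (s (ν p.2)).2.1 i₀ i₁]
  refine Circle.not_exists_contraction
    ⟨⟨fun p => hopfRatio _ _ (hfib p), continuous_hopfRatio (hγ i₀) (hγ i₁) hfib⟩,
      fun g => ⟨?_, ?_⟩⟩
  · refine hopfRatio_circleRotate 1 (hfib (0, g)) ?_
    rw [circleRotate_one]
    exact (s (ν g)).2.1 i₁ i₀
  · refine hopfRatio_circleRotate g (hfib (1, g)) ?_
    change (s (ν g)).1 i₁ 1 = circleRotate g ((s (ν g)).1 i₀ 1)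
    rw [hend, hend, if_pos rfl, if_neg hne]

/-- A map without a global section has Schwarz genus at least two. -/
theorem two_le_schwarzGenus {E B : Type*} [TopologicalSpace E] [TopologicalSpace B] (p : C(E, B))
    (h : ¬ ∃ s : C(B, E), ∀ b, p (s b) = b) : 2 ≤ schwarzGenus p := by
  refine le_iInf₂ fun r ⟨hr, U, _, hU, hs⟩ => ?_
  by_contra hlt
  have hlt' : r < 2 := by exact_mod_cast not_le.1 hlt
  obtain rfl : r = 1 := by lia
  have hU0 (b : B) : b ∈ U 0 := by
    have hb : b ∈ ⋃ j, U j := hU ▸ Set.mem_univ b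
    obtain ⟨j, hj⟩ := Set.mem_iUnion.1 hb
    rwa [Subsingleton.elim 0 j]
  obtain ⟨s, hs⟩ := hs 0
  exact h ⟨s.comp ⟨fun b => ⟨b, hU0 b⟩, by fun_prop⟩, fun b => hs ⟨b, hU0 b⟩⟩

theorem mainTheorem12 (n : ℕ) (hn : 2 ≤ n) :
    2 ≤ parametrisedTC hopfMap n ∧ parametrisedTC hopfMap n ≤ (n : ℕ∞) :=
  ⟨two_le_schwarzGenus _ (not_exists_section_multipathEnd_hopfMap hn),
    parametrisedTC_hopfMap_le (by lia)⟩
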